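/- Let $Z$ be a $2\pi$-periodic analytic parametrization of a simple closed curve $\partial\Omega=Z(\mathbb{R})\subset\mathbb{C}$, continued analytically off the real axis. For $\alpha>0$ let $A_\alpha=Z(\{s\in\mathbb{C}:|\operatorname{Im}s|<\alpha\})$, and suppose that $\alpha$ is such that $Z$ is analytic, with nonvanishing derivative, and injective modulo $2\pi$ in the closed strip $|\operatorname{Im}s|\le\alpha$ (so that $Z^{-1}$, taken modulo $2\pi$, is holomorphic in the closure of $A_\alpha$). Let $\sigma$ be a real-valued density on $\partial\Omega$ that continues to a bounded holomorphic function in the closure of $A_\alpha$. For $z\in\mathbb{C}\setminus\partial\Omega$ let $$u(z)=\int_0^{2\pi}g_z(s)\,ds,\qquad g_z(s)=\frac1{2\pi}\log\frac1{|Z(s)-z|}\;\sigma(Z(s))\,|Z'(s)|,$$ be the Laplace single-layer potential, let $$u^{(N)}(z)=\frac{2\pi}{N}\sum_{j=1}^N g_z(2\pi j/N)$$ be its $N$-point periodic trapezoid rule evaluation, and let $\epsilon_N(z)=u^{(N)}(z)-u(z)$. Then at each target point $z\in A_\alpha\setminus\partial\Omega$ there exist constants $C$ and $N_0$ such that $$|\epsilon_N(z)|\le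 C e^{-|\operatorname{Im}s|\,N}\qquad\text{for all }N\ge N_0,$$ where $Z(s)=z$, $|\operatorname{Im}s|<\alpha$. The same bound, with the same $C$ and $N_0$, holds for $\operatorname{Re}(v^{(N)}(z)-v(z))$, where $$v(z)=\frac1{2\pi}\int_0^{2\pi}L(Z(s))\,\sigma(Z(s))\,|Z'(s)|\,ds,$$ $L$ is any branch of $y\mapsto\log\frac1{y-z}$ on $\partial\Omega$ that is continuous on $\partial\Omega$ except possibly at a single point, and $v^{(N)}(z)$ is the $N$-point periodic trapezoid rule for this integral. -/

import Mathlib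

open scoped BigOperators

noncomputable section

namespace LaplaceSLP

/-- The open strip `|Im s| < α` in the parameter plane. -/
def openStrip (α : ℝ) : Set ℂ := {s : ℂ | |s.im| < α}

/-- The closed strip `|Im s| ≤ α` in the parameter plane. -/
def closedStrip (α : ℝ) : Set ℂ := {s : ℂ | |s.im| ≤ α}

/-- The curve `∂Ω = Z(ℝ)`. -/
def curve (Z : ℂ → ℂ) : Set ℂ := Set.range fun t : ℝ => Z (t : ℂ)

/-- The annular neighborhood `A_α = Z({s : |Im s| < α})` of the curve. -/
def annularNhd (Z : ℂ → ℂ) (α : ℝ) : Set ℂ := Z '' openStrip α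

/-- `Z` is (the analytic continuation of) a `2π`-periodic analytic parametrization of a simple
closed curve, and it is analytic and invertible (modulo the period) in the closed strip
`|Im s| ≤ α`, with nonvanishing derivative, so that `Z⁻¹` is holomorphic (modulo the period) in the
closure of `A_α`. On the real axis, the last two fields say that the curve is simple and that the
speed `|Z'|` is positive. -/
structure IsInvertibleOnStrip (Z : ℂ → ℂ) (α : ℝ) : Prop where
  periodic : ∀ t : ℝ, Z ((t + 2 * Real.pi : ℝ) : ℂ) = Z (t : ℂ)
  analytic : AnalyticOnNhd ℂ Z (closedStrip α)
  injective_mod_period : ∀ s ∈ closedStrip α, ∀ s' ∈ closedStrip α, Z s = Z s' →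
    ∃ k : ℤ, s' = s + 2 * Real.pi * k
  deriv_ne_zero : ∀ s ∈ closedStrip α, deriv Z s ≠ 0

/-- The real density `σ` on the curve continues to a bounded holomorphic function in the closure
of `A_α`. Only the values of `σ` on the curve matter. -/
def DensityExtends (Z : ℂ → ℂ) (α : ℝ) (σ : ℂ → ℝ) : Prop :=
  ∃ S : ℂ → ℂ, AnalyticOnNhd ℂ S (closure (annularNhd Z α)) ∧
    Bornology.IsBounded (S '' closure (annularNhd Z α)) ∧
    ∀ y ∈ curve Z, S y = (σ y : ℂ)

/-- The `N`-point periodic trapezoid rule on `[0, 2π]`, with nodes `2πj/N`, `j = 1, …, N`. -/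
def trapezoid {E : Type*} [NormedAddCommGroup E] [NormedSpace ℝ E] (N : ℕ) (f : ℝ → E) : E :=
  (2 * Real.pi / N) • ∑ j ∈ Finset.Icc 1 N, f (2 * Real.pi * j / N)

/-- The fundamental solution `Φ(x, y) = (1 / 2π) log (1 / |x - y|)` of the Laplace equation. -/
def fundSol (x y : ℂ) : ℝ := 1 / (2 * Real.pi) * Real.log (1 / ‖x - y‖)

/-- The integrand, in the parameter, of the single-layer potential
`u(z) = ∫ Φ(z, y) σ(y) ds_y` over the curve. -/
def slpIntegrand (Z : ℂ → ℂ) (σ : ℂ → ℝ) (z : ℂ) (t : ℝ) : ℝ :=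
  fundSol z (Z t) * σ (Z t) * ‖deriv Z t‖

/-- The Laplace single-layer potential `u(z)`. -/
def slp (Z : ℂ → ℂ) (σ : ℂ → ℝ) (z : ℂ) : ℝ :=
  ∫ t in (0 : ℝ)..(2 * Real.pi), slpIntegrand Z σ z t

/-- Its native `N`-point evaluation `u^{(N)}(z)`. -/
def slpNative (Z : ℂ → ℂ) (σ : ℂ → ℝ) (N : ℕ) (z : ℂ) : ℝ :=
  trapezoid N (slpIntegrand Z σ z)

/-- `L` is a branch of `y ↦ log (1 / (y - z))` on the set `Γ`, with its jump on `Γ`, if there is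
any, at a single point `y₀`. -/
structure IsLogBranch (Γ : Set ℂ) (z : ℂ) (L : ℂ → ℂ) : Prop where
  exp_eq : ∀ y ∈ Γ, Complex.exp (L y) = 1 / (y - z)
  continuousOn : ∃ y₀ : ℂ, ContinuousOn L (Γ \ {y₀})

/-- The integrand, in the parameter, of the complex potential
`v(z) = (1 / 2π) ∫ log (1 / (y - z)) σ(y) |dy|`, the logarithm being given by the branch `L`. -/
def complexSlpIntegrand (Z : ℂ → ℂ) (σ : ℂ → ℝ) (L : ℂ → ℂ) (t : ℝ) : ℂ :=
  1 / (2 * Real.pi) * L (Z t) * σ (Z t) * ‖deriv Z t‖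

/-- The complex potential `v(z)`, where `L` is a branch of `log (1 / (· - z))`. -/
def complexSlp (Z : ℂ → ℂ) (σ : ℂ → ℝ) (L : ℂ → ℂ) : ℂ :=
  ∫ t in (0 : ℝ)..(2 * Real.pi), complexSlpIntegrand Z σ L t

/-- Its native `N`-point evaluation `v^{(N)}(z)`. -/
def complexSlpNative (Z : ℂ → ℂ) (σ : ℂ → ℝ) (L : ℂ → ℂ) (N : ℕ) : ℂ :=
  trapezoid N (complexSlpIntegrand Z σ L)

end LaplaceSLP

end

/-!
Write `z = Z s₀` with `a = |Im s₀| > 0`. The error of the `N`-point periodic trapezoid rule is a sum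
over the Fourier coefficients of the integrand at the nonzero multiples of `N` (aliasing), so it is
`O(e^{-aN})` once the `n`-th coefficient is `O(e^{-a|n|})` (`ExpSeries.trapezoid_error`). The rate
has to be `a` itself, not merely every smaller rate, so a contour shift below the singularity does
not suffice, and the singularity is treated explicitly.

Up to a constant factor the integrand is `log |Z(t) - z| · σ(Z(t)) |Z'(t)|`. Since `Z` is injective
modulo `2π` and has nonvanishing derivative, `Z(s) - z` equals `(1 - e^{∓i(s - s₀)}) F(s)` with `F`
holomorphic and without zeros in the strip. The logarithm of the modulus of the first factor is
explicit, and its Taylor series gives coefficients `O(e^{-a|n|})`. Both `log |F|` and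
`σ(Z) |Z'|` on the real axis continue to periodic holomorphic functions on the strip
(`exists_extension_log_norm`, which rests on the existence of a holomorphic logarithm on a convex
open set), and therefore have coefficients `O(e^{-β|n|})` for every `β < α`
(`expSeries_of_periodic`, by shifting contours). Choosing `a < β < α`, the product has coefficients
`O(e^{-a|n|})` (`ExpSeries.mul`).

For the complex potential, `Re L(y) = log (1 / |y - z|)` on the curve for every branch `L`, so it
only remains to take the real part out of the integral. This needs integrability of `L ∘ Z`, which
holds because `L ∘ Z` differs from a continuous logarithm of `1 / (Z - z)` along the real line by a
constant on each side of its jump.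
-/

namespace LaplaceSLP

open Complex Filter Topology

/-! ### Fourier series with exponentially decaying coefficients -/

/-- `f` is the sum of a Fourier series `∑ c n e^{int}` over `n : ℤ` with `|c n| ≤ C e^{-a|n|}` for
some `C`. The period is `2π`, and the sum is required at every real `t`. -/
def ExpSeries (a : ℝ) (f : ℝ → ℂ) : Prop :=
  ∃ c : ℤ → ℂ, (∃ C : ℝ, ∀ n, ‖c n‖ ≤ C * Real.exp (-a * |(n : ℝ)|)) ∧
    ∀ t : ℝ, HasSum (fun n : ℤ => c n * exp (n * t * I)) (f t)

theorem norm_exp_int_mul_I (n : ℤ) (t : ℝ) : ‖exp (n * t * I)‖ = 1 := by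
  have := norm_exp_ofReal_mul_I ((n : ℝ) * t)
  push_cast at this
  exact this

theorem summable_exp_neg_mul_abs {a : ℝ} (ha : 0 < a) :
    Summable fun n : ℤ => Real.exp (-a * |(n : ℝ)|) := by
  have h : Summable fun n : ℕ => Real.exp (-a * (n : ℝ)) := by
    have := Real.summable_exp_nat_mul_iff.2 (neg_lt_zero.2 ha)
    simpa [mul_comm] using this
  refine Summable.of_nat_of_neg ?_ ?_
  · simpa using h
  · simpa using h

theorem ExpSeries.add {a : ℝ} {f g : ℝ → ℂ} (hf : ExpSeries a f) (hg : ExpSeries a g) :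
    ExpSeries a fun t => f t + g t := by
  obtain ⟨c, ⟨C, hC⟩, hs⟩ := hf
  obtain ⟨d, ⟨D, hD⟩, ht⟩ := hg
  refine ⟨fun n => c n + d n, ⟨C + D, fun n => (norm_add_le _ _).trans ?_⟩, fun t => ?_⟩
  · linarith [hC n, hD n]
  · simpa [add_mul] using (hs t).add (ht t)

theorem ExpSeries.const_mul {a : ℝ} {f : ℝ → ℂ} (k : ℂ) (hf : ExpSeries a f) :
    ExpSeries a fun t => k * f t := by
  obtain ⟨c, ⟨C, hC⟩, hs⟩ := hf
  refine ⟨fun n => k * c n, ⟨‖k‖ * C, fun n => ?_⟩, fun t => ?_⟩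
  · rw [norm_mul, mul_assoc]
    gcongr
    exact hC n
  · simpa [mul_assoc] using (hs t).mul_left k

theorem ExpSeries.conj {a : ℝ} {f : ℝ → ℂ} (hf : ExpSeries a f) :
    ExpSeries a fun t => (starRingEnd ℂ) (f t) := by
  obtain ⟨c, ⟨C, hC⟩, hs⟩ := hf
  refine ⟨fun n => (starRingEnd ℂ) (c (-n)), ⟨C, fun n => ?_⟩, fun t => ?_⟩
  · simpa using hC (-n)
  · have h := (Equiv.neg ℤ).hasSum_iff.2 (hasSum_conj'.2 (by simpa using hs t) :
      HasSum (fun n : ℤ => (starRingEnd ℂ) (c n * exp (n * t * I))) ((starRingEnd ℂ) (f t)))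
    refine h.congr_fun ?_
    intro n
    simp [← exp_conj]

/-- The product has the smaller of the two rates, without loss, because
`e^{-a|n-k|} e^{-b|k|} ≤ e^{-a|n|} e^{-(b-a)|k|}` and the last factor is summable in `k`. -/
theorem ExpSeries.mul {a b : ℝ} {f g : ℝ → ℂ} (ha : 0 < a) (hab : a < b)
    (hf : ExpSeries a f) (hg : ExpSeries b g) : ExpSeries a fun t => f t * g t := by
  obtain ⟨c, ⟨C, hC⟩, hs⟩ := hf
  obtain ⟨d, ⟨D, hD⟩, ht⟩ := hg
  have hC0 : 0 ≤ C := by simpa using (norm_nonneg _).trans (hC 0)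
  have hD0 : 0 ≤ D := by simpa using (norm_nonneg _).trans (hD 0)
  have hsum := summable_exp_neg_mul_abs (sub_pos.2 hab)
  have hbd : ∀ n k : ℤ, ‖c (n - k) * d k‖ ≤
      C * D * Real.exp (-a * |(n : ℝ)|) * Real.exp (-(b - a) * |(k : ℝ)|) := by
    intro n k
    rw [norm_mul]
    refine (mul_le_mul (hC _) (hD _) (norm_nonneg _) (by positivity)).trans ?_
    have h1 : Real.exp (-a * |((n - k : ℤ) : ℝ)|) * Real.exp (-b * |(k : ℝ)|) ≤
        Real.exp (-a * |(n : ℝ)|) * Real.exp (-(b - a) * |(k : ℝ)|) := by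
      rw [← Real.exp_add, ← Real.exp_add]
      apply Real.exp_le_exp.2
      have h2 : |(n : ℝ)| ≤ |((n - k : ℤ) : ℝ)| + |(k : ℝ)| := by
        have := abs_add_le ((n : ℝ) - k) k
        push_cast
        simpa using this
      nlinarith
    calc _ = C * D * (Real.exp (-a * |((n - k : ℤ) : ℝ)|) * Real.exp (-b * |(k : ℝ)|)) := by ring
      _ ≤ C * D * (Real.exp (-a * |(n : ℝ)|) * Real.exp (-(b - a) * |(k : ℝ)|)) := by gcongr
      _ = _ := by ring
  have hsn : ∀ n : ℤ, Summable fun k : ℤ => c (n - k) * d k := fun n =>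
    Summable.of_norm_bounded (hsum.mul_left _) (hbd n)
  have hnorm : ∀ (e : ℤ → ℂ) (E r : ℝ), 0 < r → (∀ n, ‖e n‖ ≤ E * Real.exp (-r * |(n : ℝ)|)) →
      ∀ t : ℝ, Summable fun n : ℤ => ‖e n * exp (n * t * I)‖ := by
    intro e E r hr he t
    refine Summable.of_nonneg_of_le (fun _ => norm_nonneg _) (fun n => ?_)
      ((summable_exp_neg_mul_abs hr).mul_left E)
    rw [norm_mul, norm_exp_int_mul_I, mul_one]
    exact he n
  refine ⟨fun n => ∑' k, c (n - k) * d k,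
    ⟨C * D * ∑' k : ℤ, Real.exp (-(b - a) * |(k : ℝ)|), fun n => ?_⟩, fun t => ?_⟩
  · refine (tsum_of_norm_bounded (hsum.mul_left _).hasSum (hbd n)).trans (le_of_eq ?_)
    rw [tsum_mul_left]
    ring
  · have hfg : Summable fun p : ℤ × ℤ =>
        c p.1 * exp (p.1 * t * I) * (d p.2 * exp (p.2 * t * I)) :=
      summable_mul_of_summable_norm (f := fun n : ℤ => c n * exp (n * t * I))
        (g := fun n : ℤ => d n * exp (n * t * I)) (hnorm c C a ha hC t)
        (hnorm d D b (ha.trans hab) hD t)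
    have h : HasSum (fun p : ℤ × ℤ => c p.1 * exp (p.1 * t * I) * (d p.2 * exp (p.2 * t * I)))
        (f t * g t) :=
      HasSum.mul (f := fun n : ℤ => c n * exp (n * t * I))
        (g := fun n : ℤ => d n * exp (n * t * I)) (hs t) (ht t) hfg
    -- Sum the double series over the fibres of `(m, k) ↦ m + k`.
    let e : ℤ × ℤ ≃ ℤ × ℤ :=
      ⟨fun p => (p.1 - p.2, p.2), fun p => (p.1 + p.2, p.2), fun p => by simp, fun p => by simp⟩
    refine ((e.hasSum_iff.2 h)).prod_fiberwise fun n => ?_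
    refine ((hsn n).hasSum.mul_right (exp (n * t * I))).congr_fun ?_
    intro k
    have : exp ((n : ℂ) * t * I) = exp (((n - k : ℤ) : ℂ) * t * I) * exp ((k : ℂ) * t * I) := by
      rw [← exp_add]
      congr 1
      push_cast
      ring
    simp only [e, Function.comp_apply, Equiv.coe_fn_mk, this]
    ring

/-- The model singularity: by the Taylor series of the logarithm, the coefficients of
`log |1 - q e^{it}|` are `-q^n / (2n)` for `n > 0` and their conjugates for `n < 0`. -/
theorem expSeries_log_norm {a : ℝ} (ha : 0 < a) {q : ℂ} (hq : ‖q‖ = Real.exp (-a)) :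
    ExpSeries a fun t : ℝ => (Real.log ‖1 - q * exp (t * I)‖ : ℂ) := by
  have key : ExpSeries a fun t : ℝ => -log (1 - q * exp (t * I)) := by
    refine ⟨fun n => if 0 ≤ n then q ^ n.toNat / n.toNat else 0, ⟨1, fun n => ?_⟩, fun t => ?_⟩
    · dsimp only
      split_ifs with h
      · lift n to ℕ using h
        rw [norm_div, norm_pow, hq, ← Real.exp_nat_mul]
        simp only [Int.toNat_natCast, Int.cast_natCast, Nat.abs_cast, norm_natCast, one_mul]
        rw [show (n : ℝ) * -a = -a * n by ring]
        rcases Nat.eq_zero_or_pos n with rfl | hn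
        · simp
        · exact div_le_self (Real.exp_pos _).le (by exact_mod_cast hn)
      · simp [(Real.exp_pos _).le]
    · have hlt : ‖q * exp (t * I)‖ < 1 := by
        rw [norm_mul, norm_exp_ofReal_mul_I, mul_one, hq]
        simpa using ha
      have h := hasSum_taylorSeries_neg_log hlt
      have hinj : Function.Injective ((↑) : ℕ → ℤ) := Nat.cast_injective
      refine (hinj.hasSum_iff ?_).1 (h.congr_fun ?_)
      · intro n hn
        have : ¬ 0 ≤ n := fun h => hn ⟨n.toNat, by simp [h]⟩
        simp [this]
      · intro n
        simp only [Function.comp_apply, Int.natCast_nonneg, if_true, Int.toNat_natCast,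
          Int.cast_natCast, mul_pow, ← exp_nat_mul]
        rw [mul_assoc (n : ℂ)]
        ring
  convert (key.add key.conj).const_mul (-1 / 2) using 2 with t
  rw [← log_re, re_eq_add_conj, map_neg]
  ring

/-! ### The periodic trapezoid rule -/

/-- Aliasing: the trapezoid rule errs on `e^{int}` only when `n` is a nonzero multiple of `N`,
where it returns `2π` instead of `0`. -/
theorem trapezoid_exp_sub {N : ℕ} (hN : 1 ≤ N) (n : ℤ) :
    trapezoid N (fun t : ℝ => exp (n * t * I)) - ∫ t in (0 : ℝ)..2 * Real.pi, exp (n * t * I) =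
      if (N : ℤ) ∣ n ∧ n ≠ 0 then (2 * Real.pi : ℂ) else 0 := by
  have hN0 : (N : ℂ) ≠ 0 := by
    have : N ≠ 0 := by omega
    exact_mod_cast this
  have hpi : (Real.pi : ℂ) ≠ 0 := by exact_mod_cast Real.pi_ne_zero
  have hint : ∫ t in (0 : ℝ)..2 * Real.pi, exp (n * t * I) =
      if n = 0 then (2 * Real.pi : ℂ) else 0 := by
    split_ifs with h
    · simp [h]
    · have h0 : (n : ℂ) * I ≠ 0 := mul_ne_zero (by exact_mod_cast h) I_ne_zero
      have h1 : ∀ t : ℝ, exp (n * t * I) = exp (n * I * t) := fun t => by ring_nf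
      simp_rw [h1]
      rw [integral_exp_mul_complex h0]
      have h2 : exp (n * I * ((2 * Real.pi : ℝ) : ℂ)) = 1 :=
        exp_eq_one_iff.2 ⟨n, by push_cast; ring⟩
      rw [h2]
      simp
  have htr : trapezoid N (fun t : ℝ => exp (n * t * I)) =
      if (N : ℤ) ∣ n then (2 * Real.pi : ℂ) else 0 := by
    set ζ : ℂ := exp (2 * Real.pi * I * n / N) with hζ
    have hpow : ∀ j : ℕ, exp (n * ((2 * Real.pi * j / N : ℝ) : ℂ) * I) = ζ ^ j := by
      intro j
      rw [hζ, ← exp_nat_mul]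
      congr 1
      push_cast
      ring
    have hone : ζ = 1 ↔ (N : ℤ) ∣ n := by
      rw [hζ, exp_eq_one_iff]
      constructor
      · rintro ⟨k, hk⟩
        refine ⟨k, ?_⟩
        have hI := I_ne_zero
        field_simp at hk
        exact_mod_cast hk
      · rintro ⟨k, rfl⟩
        refine ⟨k, ?_⟩
        push_cast
        field_simp
    unfold trapezoid
    simp_rw [hpow]
    split_ifs with h
    · rw [hone.2 h]
      simp only [one_pow, Finset.sum_const, Nat.card_Icc, add_tsub_cancel_right, nsmul_eq_mul,
        mul_one, real_smul]
      push_cast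
      field_simp
    · have hne : ζ - 1 ≠ 0 := sub_ne_zero.2 fun h' => h (hone.1 h')
      have hN1 : ζ ^ N = 1 := by
        rw [hζ, ← exp_nat_mul]
        exact exp_eq_one_iff.2 ⟨n, by field_simp⟩
      have hsum : ∑ j ∈ Finset.Icc 1 N, ζ ^ j = 0 := by
        have h1 : (∑ j ∈ Finset.range N, ζ ^ j) = 0 := by
          have := geom_sum_mul ζ N
          rw [hN1, sub_self] at this
          exact (mul_eq_zero.1 this).resolve_right hne
        rw [Finset.range_eq_Ico] at h1
        have h2 := Finset.sum_Ico_add' (fun j => ζ ^ j) 0 N 1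
        rw [zero_add] at h2
        have h3 : Finset.Icc 1 N = Finset.Ico 1 (N + 1) := by ext; simp
        rw [h3, ← h2]
        simp_rw [pow_succ, ← Finset.sum_mul, h1, zero_mul]
      rw [hsum, smul_zero]
  rw [hint, htr]
  by_cases h0 : n = 0
  · simp [h0]
  · simp [h0]

/-- The coefficients seen by aliasing sum to `O(e^{-aN})`, with a constant independent of `N`. -/
theorem exists_tsum_multiples_le {a : ℝ} (ha : 0 < a) : ∃ K : ℝ, ∀ N : ℕ, 1 ≤ N →
    Summable (fun n : ℤ => if (N : ℤ) ∣ n ∧ n ≠ 0 then Real.exp (-a * |(n : ℝ)|) else 0) ∧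
    ∑' n : ℤ, (if (N : ℤ) ∣ n ∧ n ≠ 0 then Real.exp (-a * |(n : ℝ)|) else 0) ≤
      K * Real.exp (-a * N) := by
  have hs := summable_exp_neg_mul_abs ha
  refine ⟨Real.exp a * ∑' m : ℤ, Real.exp (-a * |(m : ℝ)|), fun N hN => ?_⟩
  have hN0 : (N : ℤ) ≠ 0 := by omega
  have hinj : Function.Injective fun m : ℤ => (N : ℤ) * m := mul_right_injective₀ hN0
  set F : ℤ → ℝ := fun n => if (N : ℤ) ∣ n ∧ n ≠ 0 then Real.exp (-a * |(n : ℝ)|) else 0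
  have hsupp : ∀ n ∉ Set.range fun m : ℤ => (N : ℤ) * m, F n = 0 := by
    intro n hn
    refine if_neg fun h => hn ?_
    obtain ⟨k, rfl⟩ := h.1
    exact ⟨k, rfl⟩
  -- For `m ≠ 0`, `|m| N ≥ N + |m| - 1`, which is where the factor `e^a` comes from.
  have hF : ∀ m : ℤ, F (N * m) ≤ Real.exp (-a * N) * Real.exp a * Real.exp (-a * |(m : ℝ)|) := by
    intro m
    simp only [F]
    split_ifs with h
    · rw [← Real.exp_add, ← Real.exp_add]
      apply Real.exp_le_exp.2
      have hm : m ≠ 0 := fun h' => h.2 (by simp [h'])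
      have h1 : (1 : ℝ) ≤ |(m : ℝ)| := by exact_mod_cast Int.one_le_abs hm
      have h2 : (1 : ℝ) ≤ N := by exact_mod_cast hN
      push_cast
      rw [abs_mul, Nat.abs_cast]
      nlinarith [mul_nonneg (sub_nonneg.2 h1) (sub_nonneg.2 h2)]
    · positivity
  have hF0 : ∀ n, 0 ≤ F n := fun n => by
    simp only [F]
    split_ifs
    · positivity
    · rfl
  have hsF : Summable (F ∘ fun m : ℤ => (N : ℤ) * m) :=
    Summable.of_nonneg_of_le (fun _ => hF0 _) hF (hs.mul_left _)
  refine ⟨(hinj.summable_iff hsupp).1 hsF, ?_⟩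
  rw [← ((hinj.hasSum_iff hsupp).1 hsF.hasSum).tsum_eq.symm]
  refine (hsF.tsum_le_tsum hF (hs.mul_left _)).trans (le_of_eq ?_)
  rw [tsum_mul_left]
  ring

/-- If the Fourier coefficients decay like `e^{-a|n|}`, the periodic trapezoid rule converges at
exactly the rate `e^{-aN}`. -/
theorem ExpSeries.trapezoid_error {a : ℝ} (ha : 0 < a) {f : ℝ → ℂ} (hf : ExpSeries a f) :
    ∃ K : ℝ, ∀ N : ℕ, 1 ≤ N →
      ‖trapezoid N f - ∫ t in (0 : ℝ)..2 * Real.pi, f t‖ ≤ K * Real.exp (-a * N) := by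
  obtain ⟨c, ⟨C, hC⟩, hs⟩ := hf
  have hC0 : 0 ≤ C := by simpa using (norm_nonneg _).trans (hC 0)
  obtain ⟨K, hK⟩ := exists_tsum_multiples_le ha
  refine ⟨2 * Real.pi * C * K, fun N hN => ?_⟩
  obtain ⟨hsm, hle⟩ := hK N hN
  have hcont : ∀ n : ℤ, Continuous fun t : ℝ => c n * exp (n * t * I) := fun n => by fun_prop
  have hI : HasSum (fun n : ℤ => ∫ t in (0 : ℝ)..2 * Real.pi, c n * exp (n * t * I))
      (∫ t in (0 : ℝ)..2 * Real.pi, f t) := by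
    refine intervalIntegral.hasSum_integral_of_dominated_convergence
      (fun n _ => C * Real.exp (-a * |(n : ℝ)|))
      (fun n => (hcont n).aestronglyMeasurable) (fun n => ?_) ?_ ?_ ?_
    · refine Filter.Eventually.of_forall fun t _ => ?_
      rw [norm_mul, norm_exp_int_mul_I, mul_one]
      exact hC n
    · exact Filter.Eventually.of_forall fun t _ => (summable_exp_neg_mul_abs ha).mul_left C
    · exact intervalIntegrable_const
    · exact Filter.Eventually.of_forall fun t _ => hs t
  have hT : HasSum (fun n : ℤ => trapezoid N fun t : ℝ => c n * exp (n * t * I))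
      (trapezoid N f) := by
    have h := hasSum_sum (s := Finset.Icc 1 N) fun j _ => hs (2 * Real.pi * j / N)
    exact h.const_smul (2 * Real.pi / N : ℝ)
  have hD := hT.sub hI
  have hterm : ∀ n : ℤ, (trapezoid N fun t : ℝ => c n * exp (n * t * I)) -
      ∫ t in (0 : ℝ)..2 * Real.pi, c n * exp (n * t * I) =
      c n * if (N : ℤ) ∣ n ∧ n ≠ 0 then (2 * Real.pi : ℂ) else 0 := by
    intro n
    rw [← trapezoid_exp_sub hN n, intervalIntegral.integral_const_mul, mul_sub]
    congr 1
    simp only [trapezoid, ← Finset.mul_sum, mul_smul_comm]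
  simp_rw [hterm] at hD
  rw [← hD.tsum_eq]
  refine (tsum_of_norm_bounded (hsm.mul_left (2 * Real.pi * C)).hasSum fun n => ?_).trans ?_
  · split_ifs
    · rw [norm_mul, mul_comm, mul_assoc]
      have : ‖(2 * Real.pi : ℂ)‖ = 2 * Real.pi := by
        simp [abs_of_pos Real.pi_pos]
      rw [this]
      gcongr
      exact hC n
    · simp
  · rw [tsum_mul_left, mul_assoc _ K]
    gcongr

/-! ### Holomorphic functions on a strip -/

theorem isOpen_openStrip (α : ℝ) : IsOpen (openStrip α) :=
  isOpen_lt (continuous_abs.comp continuous_im) continuous_const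

theorem convex_openStrip (α : ℝ) : Convex ℝ (openStrip α) := by
  have : openStrip α = imLm ⁻¹' Set.Ioo (-α) α := by
    ext s
    simp [openStrip, abs_lt]
  rw [this]
  exact (convex_Ioo _ _).linear_preimage imLm

theorem openStrip_subset_closedStrip (α : ℝ) : openStrip α ⊆ closedStrip α := fun s hs =>
  show |s.im| ≤ α from le_of_lt hs

theorem ofReal_mem_openStrip {α : ℝ} (hα : 0 < α) (t : ℝ) : (t : ℂ) ∈ openStrip α := by
  simpa [openStrip] using hα

theorem add_ofReal_mem_openStrip {α : ℝ} {s : ℂ} (hs : s ∈ openStrip α) (t : ℝ) :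
    s + t ∈ openStrip α := by
  simpa [openStrip] using hs

theorem conj_mem_openStrip {α : ℝ} {s : ℂ} (hs : s ∈ openStrip α) :
    (starRingEnd ℂ) s ∈ openStrip α := by
  simpa [openStrip] using hs

theorem frequently_ofReal_nhdsNE_zero {P : ℂ → Prop} (h : ∀ t : ℝ, P t) :
    ∃ᶠ s in 𝓝[≠] (0 : ℂ), P s := by
  have ht : Tendsto (fun t : ℝ => (t : ℂ)) (𝓝[≠] 0) (𝓝[≠] 0) := by
    refine tendsto_nhdsWithin_of_tendsto_nhds_of_eventually_within _ ?_ ?_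
    · have := continuous_ofReal.tendsto 0
      rw [ofReal_zero] at this
      exact this.mono_left nhdsWithin_le_nhds
    · filter_upwards [self_mem_nhdsWithin] with t ht
      simpa using ht
  exact ht.frequently (Frequently.of_forall h)

/-- By the identity theorem, periodicity on the real axis propagates to the strip. -/
theorem add_two_pi_eq_of_periodic_ofReal {α : ℝ} (hα : 0 < α) {f : ℂ → ℂ}
    (hf : DifferentiableOn ℂ f (openStrip α))
    (hper : ∀ t : ℝ, f ((t + 2 * Real.pi : ℝ) : ℂ) = f t) {s : ℂ} (hs : s ∈ openStrip α) :
    f (s + (2 * Real.pi : ℝ)) = f s := by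
  have hg : DifferentiableOn ℂ (fun s => f (s + (2 * Real.pi : ℝ))) (openStrip α) :=
    hf.comp (by fun_prop) fun s hs => add_ofReal_mem_openStrip hs _
  refine (hg.analyticOnNhd (isOpen_openStrip α)).eqOn_of_preconnected_of_frequently_eq
    (hf.analyticOnNhd (isOpen_openStrip α)) (convex_openStrip α).isPreconnected
    (z₀ := 0) (by simpa using ofReal_mem_openStrip hα 0)
    (frequently_ofReal_nhdsNE_zero fun t => ?_) hs
  rw [← hper t]
  push_cast
  rfl

/-- The contour of a Fourier integral can be moved from the real axis to the line `Im s = β`,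
since the integrals over the vertical sides cancel by periodicity. -/
theorem norm_integral_mul_exp_le {α : ℝ} {f : ℂ → ℂ} (hα : 0 < α)
    (hf : DifferentiableOn ℂ f (openStrip α))
    (hper : ∀ t : ℝ, f ((t + 2 * Real.pi : ℝ) : ℂ) = f t) {M β : ℝ} (hβ : |β| < α)
    (hM : ∀ x ∈ Set.Icc (0 : ℝ) (2 * Real.pi), ‖f (x + β * I)‖ ≤ M) (n : ℤ) :
    ‖∫ x in (0 : ℝ)..2 * Real.pi, f x * exp (-n * x * I)‖ ≤
      2 * Real.pi * M * Real.exp (n * β) := by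
  set g : ℂ → ℂ := fun s => f s * exp (-n * s * I) with hg
  have hgd : DifferentiableOn ℂ g (openStrip α) := hf.mul (by fun_prop)
  have hgper : ∀ s ∈ openStrip α, g (s + (2 * Real.pi : ℝ)) = g s := by
    intro s hs
    simp only [hg]
    rw [add_two_pi_eq_of_periodic_ofReal hα hf hper hs]
    congr 1
    refine exp_eq_exp_iff_exists_int.2 ⟨-n, ?_⟩
    push_cast
    ring
  have hrect := integral_boundary_rect_eq_zero_of_differentiableOn g 0 (2 * Real.pi + β * I)
    (hgd.mono ?_)
  swap
  · intro s hs
    have him := hs.2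
    simp only [zero_im, add_im, mul_im, re_ofNat, ofReal_im, mul_zero, im_ofNat, ofReal_re,
      zero_mul, add_zero, I_im, mul_one, I_re, zero_add, Set.mem_preimage] at him
    have : |s.im| ≤ |β| := by
      have := Set.abs_sub_left_of_mem_uIcc him
      simpa using this
    exact this.trans_lt hβ
  have hvert : ∀ y ∈ Set.uIcc 0 β, g ((2 * Real.pi : ℝ) + y * I) = g ((0 : ℝ) + y * I) := by
    intro y hy
    have : |y| ≤ |β| := by simpa using Set.abs_sub_left_of_mem_uIcc hy
    have hmem : ((0 : ℝ) + y * I : ℂ) ∈ openStrip α := by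
      simpa [openStrip] using this.trans_lt hβ
    rw [← hgper _ hmem]
    congr 1
    push_cast
    ring
  have e1 : (2 * Real.pi + β * I : ℂ).re = 2 * Real.pi := by simp
  have e2 : (2 * Real.pi + β * I : ℂ).im = β := by simp
  rw [e1, e2, zero_re, zero_im, intervalIntegral.integral_congr hvert] at hrect
  have heq : ∫ x in (0 : ℝ)..2 * Real.pi, f x * exp (-n * x * I) =
      ∫ x in (0 : ℝ)..2 * Real.pi, g (x + β * I) := by
    have : ∫ x in (0 : ℝ)..2 * Real.pi, f x * exp (-n * x * I) =
      ∫ x in (0 : ℝ)..2 * Real.pi, g (x + (0 : ℝ) * I) := by simp [hg]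
    rw [this]
    linear_combination hrect
  rw [heq]
  have hpi := Real.two_pi_pos
  refine (intervalIntegral.norm_integral_le_of_norm_le_const
    (C := M * Real.exp (n * β)) fun x hx => ?_).trans (le_of_eq ?_)
  · rw [Set.uIoc_of_le hpi.le] at hx
    simp only [hg]
    rw [norm_mul, norm_exp]
    have : (-(n : ℂ) * (x + β * I) * I).re = n * β := by simp
    rw [this]
    gcongr
    exact hM x ⟨hx.1.le, hx.2⟩
  · rw [sub_zero, abs_of_pos hpi]
    ring

theorem expSeries_of_periodic {α β : ℝ} (hβ : 0 < β) (hβα : β < α) {f : ℂ → ℂ}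
    (hf : DifferentiableOn ℂ f (openStrip α))
    (hper : ∀ t : ℝ, f ((t + 2 * Real.pi : ℝ) : ℂ) = f t) :
    ExpSeries β fun t : ℝ => f t := by
  have hα := hβ.trans hβα
  have hbd : ∀ γ : ℝ, |γ| < α → ∃ M, ∀ x ∈ Set.Icc (0 : ℝ) (2 * Real.pi),
      ‖f (x + γ * I)‖ ≤ M := by
    intro γ hγ
    refine isCompact_Icc.exists_bound_of_continuousOn
      (hf.continuousOn.comp (by fun_prop) fun x _ => ?_)
    simpa [openStrip] using hγ
  obtain ⟨M₁, hM₁⟩ := hbd β (by rwa [abs_of_pos hβ])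
  obtain ⟨M₂, hM₂⟩ := hbd (-β) (by rwa [abs_neg, abs_of_pos hβ])
  have hM₁0 : 0 ≤ M₁ := (norm_nonneg _).trans (hM₁ 0 ⟨le_rfl, Real.two_pi_pos.le⟩)
  have hM₂0 : 0 ≤ M₂ := (norm_nonneg _).trans (hM₂ 0 ⟨le_rfl, Real.two_pi_pos.le⟩)
  have hcont : Continuous fun t : ℝ => f t :=
    hf.continuousOn.comp_continuous continuous_ofReal (ofReal_mem_openStrip hα)
  have hp : Function.Periodic (fun t : ℝ => f t) (2 * Real.pi) := hper
  have : Fact (0 < 2 * Real.pi) := ⟨Real.two_pi_pos⟩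
  let F : C(AddCircle (2 * Real.pi), ℂ) := ⟨hp.lift, continuous_coinduced_dom.2 hcont⟩
  have hFt : ∀ t : ℝ, F (t : AddCircle (2 * Real.pi)) = f t := fun t => rfl
  have hfour : ∀ (n : ℤ) (t : ℝ),
      fourier n (t : AddCircle (2 * Real.pi)) = exp (n * t * I) := by
    intro n t
    rw [fourier_coe_apply]
    congr 1
    have : (Real.pi : ℂ) ≠ 0 := by exact_mod_cast Real.pi_ne_zero
    push_cast
    field_simp
  have hcoef : ∀ n : ℤ, ‖fourierCoeff F n‖ ≤ (M₁ + M₂) * Real.exp (-β * |(n : ℝ)|) := by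
    intro n
    have h1 : fourierCoeff F n = (1 / (2 * Real.pi)) •
        ∫ x in (0 : ℝ)..2 * Real.pi, f x * exp (-n * x * I) := by
      rw [fourierCoeff_eq_intervalIntegral F n 0, zero_add]
      congr 2 with x
      rw [hfour, hFt, smul_eq_mul, mul_comm]
      push_cast
      rfl
    have h2 : ‖∫ x in (0 : ℝ)..2 * Real.pi, f x * exp (-n * x * I)‖ ≤
        2 * Real.pi * (M₁ + M₂) * Real.exp (-β * |(n : ℝ)|) := by
      have hpi := Real.pi_pos
      rcases le_total 0 n with hn | hn
      · refine (norm_integral_mul_exp_le hα hf hper (β := -β)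
          (by rwa [abs_neg, abs_of_pos hβ]) hM₂ n).trans ?_
        rw [abs_of_nonneg (by exact_mod_cast hn), mul_comm (n : ℝ)]
        gcongr
        linarith
      · refine (norm_integral_mul_exp_le hα hf hper (β := β)
          (by rwa [abs_of_pos hβ]) hM₁ n).trans ?_
        rw [abs_of_nonpos (by exact_mod_cast hn), mul_comm (n : ℝ), neg_mul_neg]
        gcongr
        linarith
    rw [h1, norm_smul, Real.norm_of_nonneg (by positivity)]
    calc _ ≤ 1 / (2 * Real.pi) * (2 * Real.pi * (M₁ + M₂) * Real.exp (-β * |(n : ℝ)|)) := by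
          gcongr
      _ = _ := by field_simp
  refine ⟨fourierCoeff F, ⟨_, hcoef⟩, fun t => ?_⟩
  have hsum := has_pointwise_sum_fourier_series_of_summable (f := F)
    (Summable.of_norm_bounded ((summable_exp_neg_mul_abs hβ).mul_left _) hcoef) t
  simpa only [hfour, smul_eq_mul, hFt] using hsum

theorem exists_differentiableOn_log {U : Set ℂ} (hU : IsOpen U) (hc : Convex ℝ U)
    (hne : U.Nonempty) {F : ℂ → ℂ} (hF : DifferentiableOn ℂ F U) (h0 : ∀ s ∈ U, F s ≠ 0) :
    ∃ l : ℂ → ℂ, DifferentiableOn ℂ l U ∧ ∀ s ∈ U, exp (l s) = F s := by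
  have hsc : IsSimplyConnected U := by
    have := hc.contractibleSpace hne
    unfold IsSimplyConnected
    infer_instance
  obtain ⟨l, hl, hexp⟩ := exists_continuousOn_eqOn_exp_comp hsc hU hF.continuousOn
    (by rintro ⟨s, hs, h⟩; exact h0 s hs h)
  refine ⟨l, fun p hp => ?_, hexp⟩
  have hFp : DifferentiableAt ℂ F p := (hF p hp).differentiableAt (hU.mem_nhds hp)
  have hlp : ContinuousAt l p := (hl p hp).continuousAt (hU.mem_nhds hp)
  -- Near `p` the continuous branch is the principal one, shifted by a constant.
  have hev : l =ᶠ[𝓝 p] fun s => l p + log (F s / F p) := by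
    have h1 : Tendsto (fun s => (l s - l p).im) (𝓝 p) (𝓝 0) := by
      have : ContinuousAt (fun s => (l s - l p).im) p :=
        continuous_im.continuousAt.comp (hlp.sub continuousAt_const)
      simpa [ContinuousAt] using this
    filter_upwards [hU.mem_nhds hp, h1.eventually (Ioo_mem_nhds (neg_lt_zero.2 Real.pi_pos)
      Real.pi_pos)] with s hs him
    rw [← hexp hs, ← hexp hp, Function.comp_apply, Function.comp_apply, ← exp_sub,
      log_exp him.1 him.2.le]
    ring
  refine (DifferentiableAt.congr_of_eventuallyEq ?_ hev).differentiableWithinAt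
  refine (differentiableAt_const _).add (DifferentiableAt.clog (hFp.div_const _) ?_)
  rw [div_self (h0 p hp)]
  exact one_mem_slitPlane

/-- `log |F|` on the real axis continues holomorphically to the strip, as
`(l(s) + conj (l (conj s))) / 2` with `l` a branch of `log F`. The branch `l` itself need not be
periodic, as `F` may have a nonzero winding number along the period. -/
theorem exists_extension_log_norm {α : ℝ} (hα : 0 < α) {F : ℂ → ℂ}
    (hF : DifferentiableOn ℂ F (openStrip α)) (h0 : ∀ s ∈ openStrip α, F s ≠ 0) :
    ∃ G : ℂ → ℂ, DifferentiableOn ℂ G (openStrip α) ∧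
      ∀ t : ℝ, G t = (Real.log ‖F t‖ : ℝ) := by
  obtain ⟨l, hl, hexp⟩ := exists_differentiableOn_log (isOpen_openStrip α) (convex_openStrip α)
    ⟨0, by simpa using ofReal_mem_openStrip hα 0⟩ hF h0
  have hl' : DifferentiableOn ℂ (starRingEnd ℂ ∘ l ∘ starRingEnd ℂ) (openStrip α) := by
    intro s hs
    have := (hl _ (conj_mem_openStrip hs)).differentiableAt
      ((isOpen_openStrip α).mem_nhds (conj_mem_openStrip hs))
    exact (differentiableAt_conj_conj_iff.2 this).differentiableWithinAt
  refine ⟨fun s => (l s + (starRingEnd ℂ ∘ l ∘ starRingEnd ℂ) s) / 2,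
    (hl.add hl').div_const 2, fun t => ?_⟩
  rw [← hexp t (ofReal_mem_openStrip hα t), norm_exp, Real.log_exp, re_eq_add_conj]
  simp

/-- The quotient of two holomorphic functions with the same zeros, all of them simple, extends to
a holomorphic function without zeros. -/
theorem exists_differentiableOn_quotient {U : Set ℂ} (hU : IsOpen U) {f g : ℂ → ℂ}
    (hf : DifferentiableOn ℂ f U) (hg : DifferentiableOn ℂ g U)
    (hfg : ∀ s ∈ U, f s = 0 ↔ g s = 0) (hf' : ∀ s ∈ U, f s = 0 → deriv f s ≠ 0)
    (hg' : ∀ s ∈ U, g s = 0 → deriv g s ≠ 0) :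
    ∃ F : ℂ → ℂ, DifferentiableOn ℂ F U ∧ (∀ s ∈ U, F s ≠ 0) ∧ ∀ s ∈ U, f s = g s * F s := by
  classical
  refine ⟨fun s => if g s = 0 then deriv f s / deriv g s else f s / g s, fun p hp => ?_,
    fun s hs => ?_, fun s hs => ?_⟩
  · by_cases hgp : g p = 0
    · have hfp := (hfg p hp).2 hgp
      have hdg : DifferentiableAt ℂ (dslope g p) p :=
        (((differentiableOn_dslope (hU.mem_nhds hp)).2 hg) p hp).differentiableAt
          (hU.mem_nhds hp)
      have hdf : DifferentiableAt ℂ (dslope f p) p :=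
        (((differentiableOn_dslope (hU.mem_nhds hp)).2 hf) p hp).differentiableAt
          (hU.mem_nhds hp)
      have hne : dslope g p p ≠ 0 := by
        rw [dslope_same]
        exact hg' p hp hgp
      refine (DifferentiableAt.congr_of_eventuallyEq (hdf.div hdg hne) ?_).differentiableWithinAt
      filter_upwards [hdg.continuousAt.eventually_ne hne] with s hs
      by_cases hsp : s = p
      · subst hsp
        simp [hgp]
      · have h1 : g s = (s - p) * dslope g p s := by
          rw [dslope_of_ne _ hsp, ← smul_eq_mul, sub_smul_slope, hgp]
          simp
        have h2 : f s = (s - p) * dslope f p s := by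
          rw [dslope_of_ne _ hsp, ← smul_eq_mul, sub_smul_slope, hfp]
          simp
        have h3 : g s ≠ 0 := by
          rw [h1]
          exact mul_ne_zero (sub_ne_zero.2 hsp) hs
        rw [if_neg h3, h1, h2, Pi.div_apply, mul_div_mul_left _ _ (sub_ne_zero.2 hsp)]
    · have hgd := (hg p hp).differentiableAt (hU.mem_nhds hp)
      have hfd := (hf p hp).differentiableAt (hU.mem_nhds hp)
      refine (DifferentiableAt.congr_of_eventuallyEq (hfd.div hgd hgp) ?_).differentiableWithinAt
      filter_upwards [hgd.continuousAt.eventually_ne hgp] with s hs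
      simp [hs]
  · dsimp only
    split_ifs with h
    · exact div_ne_zero (hf' s hs ((hfg s hs).2 h)) (hg' s hs h)
    · exact div_ne_zero (fun h' => h ((hfg s hs).1 h')) h
  · dsimp only
    split_ifs with h
    · rw [h, zero_mul, (hfg s hs).2 h]
    · field_simp

/-! ### The logarithmic kernel in the parameter -/

/-- The periodic model function with simple zeros exactly at `s₀ + 2πℤ`. It is
`1 - e^{∓i(s - s₀)}`, with the sign for which the exponential has modulus `e^{-|Im s₀|} < 1` on
the real axis. -/
theorem exists_periodic_simple_zero {s₀ : ℂ} (h0 : s₀.im ≠ 0) :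
    ∃ E : ℂ → ℂ, Differentiable ℂ E ∧
      (∀ s, E s = 0 ↔ ∃ k : ℤ, s = s₀ + 2 * Real.pi * k) ∧ (∀ s, E s = 0 → deriv E s ≠ 0) ∧
      (∀ s, E (s + (2 * Real.pi : ℝ)) = E s) ∧
      ExpSeries |s₀.im| fun t : ℝ => (Real.log ‖E t‖ : ℂ) := by
  obtain ⟨e, he, q, hq, hE⟩ : ∃ e : ℤ, (e = 1 ∨ e = -1) ∧ ∃ q : ℂ, ‖q‖ = Real.exp (-|s₀.im|) ∧
      ∀ t : ℝ, ‖1 - exp (e * I * (t - s₀))‖ = ‖1 - q * exp (t * I)‖ := by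
    rcases lt_or_gt_of_ne h0 with h | h
    · refine ⟨1, Or.inl rfl, exp (-I * s₀), ?_, fun t => ?_⟩
      · rw [norm_exp, abs_of_neg h]
        simp
      · rw [← exp_add]
        congr 3
        push_cast
        ring
    · refine ⟨-1, Or.inr rfl, exp (-I * (starRingEnd ℂ) s₀), ?_, fun t => ?_⟩
      · rw [norm_exp, abs_of_pos h]
        simp
      · rw [← exp_add, ← norm_conj, map_sub, map_one, ← exp_conj]
        congr 3
        simp
        ring
  have he1 : e * e = 1 := by rcases he with rfl | rfl <;> rfl
  have he1c : (e : ℂ) * e = 1 := by exact_mod_cast he1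
  have he0 : (e : ℂ) ≠ 0 := by
    intro h
    simp [h] at he1c
  have hderiv : ∀ s, HasDerivAt (fun s => 1 - exp (e * I * (s - s₀)))
      (-(exp (e * I * (s - s₀)) * (e * I * 1))) s := fun s =>
    ((((hasDerivAt_id s).sub_const s₀).const_mul (e * I)).cexp).const_sub 1
  refine ⟨fun s => 1 - exp (e * I * (s - s₀)), fun s => (hderiv s).differentiableAt,
    fun s => ?_, fun s _ => ?_, fun s => ?_, ?_⟩
  · rw [sub_eq_zero, eq_comm, exp_eq_one_iff]
    constructor
    · rintro ⟨k, hk⟩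
      refine ⟨e * k, ?_⟩
      have h1 : e * (s - s₀) = 2 * Real.pi * k :=
        mul_right_cancel₀ I_ne_zero (by linear_combination hk)
      push_cast
      linear_combination (e : ℂ) * h1 - (s - s₀) * he1c
    · rintro ⟨k, rfl⟩
      exact ⟨e * k, by push_cast; ring⟩
  · rw [(hderiv s).deriv]
    exact neg_ne_zero.2 (mul_ne_zero (exp_ne_zero _)
      (mul_ne_zero (mul_ne_zero he0 I_ne_zero) one_ne_zero))
  · dsimp only
    congr 1
    refine exp_eq_exp_iff_exists_int.2 ⟨e, ?_⟩
    push_cast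
    ring
  · simp_rw [hE]
    exact expSeries_log_norm (abs_pos.2 h0) hq

namespace IsInvertibleOnStrip

variable {Z : ℂ → ℂ} {α : ℝ}

theorem differentiableOn (hZ : IsInvertibleOnStrip Z α) : DifferentiableOn ℂ Z (openStrip α) :=
  (hZ.analytic.mono (openStrip_subset_closedStrip α)).differentiableOn

theorem add_two_pi (hZ : IsInvertibleOnStrip Z α) (hα : 0 < α) {s : ℂ} (hs : s ∈ openStrip α) :
    Z (s + (2 * Real.pi : ℝ)) = Z s :=
  add_two_pi_eq_of_periodic_ofReal hα hZ.differentiableOn hZ.periodic hs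

theorem add_two_pi_mul_int (hZ : IsInvertibleOnStrip Z α) (hα : 0 < α) {s : ℂ}
    (hs : s ∈ openStrip α) (k : ℤ) : Z (s + 2 * Real.pi * k) = Z s := by
  have hp : Function.Periodic (fun t : ℝ => Z (s + t)) (2 * Real.pi) := by
    intro t
    dsimp only
    have := hZ.add_two_pi hα (add_ofReal_mem_openStrip hs t)
    rw [← this]
    push_cast
    ring_nf
  have := hp.int_mul k 0
  simp only [zero_add, ofReal_zero, add_zero] at this
  rw [← this]
  push_cast
  ring_nf

theorem deriv_add_two_pi (hZ : IsInvertibleOnStrip Z α) (hα : 0 < α) {s : ℂ}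
    (hs : s ∈ openStrip α) : deriv Z (s + (2 * Real.pi : ℝ)) = deriv Z s := by
  rw [← deriv_comp_add_const]
  refine EventuallyEq.deriv_eq ?_
  filter_upwards [(isOpen_openStrip α).mem_nhds hs] with w hw
  exact hZ.add_two_pi hα hw

/-- `Z - Z s₀` is the model function with zeros `s₀ + 2πℤ` times a function without zeros in the
strip, so the model carries the whole singularity of `log |Z - Z s₀|`. -/
theorem expSeries_log_norm_sub (hZ : IsInvertibleOnStrip Z α) (hα : 0 < α) {s₀ : ℂ}
    (hs₀ : s₀ ∈ openStrip α) (h0 : s₀.im ≠ 0) :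
    ExpSeries |s₀.im| fun t : ℝ => (Real.log ‖Z t - Z s₀‖ : ℂ) := by
  obtain ⟨E, hE, hEz, hE', hEper, hElog⟩ := exists_periodic_simple_zero h0
  have hzero : ∀ s ∈ openStrip α, Z s - Z s₀ = 0 ↔ E s = 0 := by
    intro s hs
    rw [hEz, sub_eq_zero]
    constructor
    · intro h
      exact hZ.injective_mod_period s₀ (openStrip_subset_closedStrip α hs₀) s
        (openStrip_subset_closedStrip α hs) h.symm
    · rintro ⟨k, rfl⟩
      exact hZ.add_two_pi_mul_int hα hs₀ k
  obtain ⟨F, hF, hF0, hFE⟩ := exists_differentiableOn_quotient (isOpen_openStrip α)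
    (hZ.differentiableOn.sub_const (Z s₀)) hE.differentiableOn hzero
    (fun s hs _ => by
      rw [deriv_sub_const]
      exact hZ.deriv_ne_zero s (openStrip_subset_closedStrip α hs))
    (fun s _ h => hE' s h)
  obtain ⟨G, hG, hGt⟩ := exists_extension_log_norm hα hF hF0
  have hEt : ∀ t : ℝ, E t ≠ 0 := by
    intro t h
    obtain ⟨k, hk⟩ := (hEz t).1 h
    apply h0
    have := congrArg im hk
    simpa [mul_assoc] using this.symm
  have hFper : ∀ t : ℝ, F ((t + 2 * Real.pi : ℝ) : ℂ) = F t := by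
    intro t
    have ht := ofReal_mem_openStrip hα t
    have h1 := hFE t ht
    have h2 := hFE _ (add_ofReal_mem_openStrip ht (2 * Real.pi))
    rw [hEper, hZ.add_two_pi hα ht, h1] at h2
    rw [ofReal_add]
    exact (mul_left_cancel₀ (hEt t) h2).symm
  have hGexp := expSeries_of_periodic (abs_pos.2 h0) hs₀ hG fun t => by
    rw [hGt, hGt, hFper]
  convert hElog.add hGexp using 2 with t
  have ht := ofReal_mem_openStrip hα t
  rw [hGt, hFE t ht, norm_mul, Real.log_mul (norm_ne_zero_iff.2 (hEt t))
    (norm_ne_zero_iff.2 (hF0 t ht)), ofReal_add]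

/-- The speed `|Z'|` continues holomorphically as the exponential of the continuation of
`log |Z'|`. -/
theorem expSeries_density (hZ : IsInvertibleOnStrip Z α) {σ : ℂ → ℝ}
    (hσ : DensityExtends Z α σ) {β : ℝ} (hβ : 0 < β) (hβα : β < α) :
    ExpSeries β fun t : ℝ => ((σ (Z t) * ‖deriv Z t‖ : ℝ) : ℂ) := by
  have hα := hβ.trans hβα
  obtain ⟨S, hS, -, hSσ⟩ := hσ
  obtain ⟨G, hG, hGt⟩ := exists_extension_log_norm hα
    (hZ.differentiableOn.deriv (isOpen_openStrip α))
    fun s hs => hZ.deriv_ne_zero s (openStrip_subset_closedStrip α hs)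
  have hSZ : DifferentiableOn ℂ (fun s => S (Z s)) (openStrip α) :=
    hS.differentiableOn.comp hZ.differentiableOn fun s hs => subset_closure ⟨s, hs, rfl⟩
  have hH : DifferentiableOn ℂ (fun s => S (Z s) * exp (G s)) (openStrip α) := hSZ.mul hG.cexp
  have hHt : ∀ t : ℝ, S (Z t) * exp (G t) = ((σ (Z t) * ‖deriv Z t‖ : ℝ) : ℂ) := by
    intro t
    have hd := hZ.deriv_ne_zero t (openStrip_subset_closedStrip α (ofReal_mem_openStrip hα t))
    rw [hSσ _ ⟨t, rfl⟩, hGt, ← ofReal_exp, Real.exp_log (norm_pos_iff.2 hd), ofReal_mul]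
  have := expSeries_of_periodic hβ hβα hH fun t => by
    rw [hHt, hHt, hZ.periodic, ofReal_add, hZ.deriv_add_two_pi hα (ofReal_mem_openStrip hα t)]
  simpa only [hHt] using this

/-! ### The complex potential and the error bound -/

theorem continuous_param (hZ : IsInvertibleOnStrip Z α) (hα : 0 < α) :
    Continuous fun t : ℝ => Z t :=
  hZ.differentiableOn.continuousOn.comp_continuous continuous_ofReal
    (ofReal_mem_openStrip hα)

/-- A branch of the logarithm along the curve, cut at one point, is bounded. Without
integrability the complex potential would be the junk value `0`. -/
theorem intervalIntegrable_logBranch (hZ : IsInvertibleOnStrip Z α) (hα : 0 < α) {z : ℂ}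
    (hz : z ∉ curve Z) {L : ℂ → ℂ} (hL : IsLogBranch (curve Z) z L) :
    IntervalIntegrable (fun t : ℝ => L (Z t)) MeasureTheory.volume 0 (2 * Real.pi) := by
  have hpi := Real.pi_pos
  have hZc := hZ.continuous_param hα
  have hne : ∀ t : ℝ, Z t - z ≠ 0 := fun t h => hz ⟨t, sub_eq_zero.1 h⟩
  obtain ⟨l, hl, hlexp⟩ : ∃ l : ℝ → ℂ, Continuous l ∧ ∀ t, exp (l t) = 1 / (Z t - z) := by
    have hsc : IsSimplyConnected (Set.univ : Set ℝ) := by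
      have := (convex_univ (𝕜 := ℝ) (E := ℝ)).contractibleSpace Set.univ_nonempty
      unfold IsSimplyConnected
      infer_instance
    obtain ⟨l, hl, hexp⟩ := exists_continuousOn_eqOn_exp_comp hsc isOpen_univ
      (g := fun t : ℝ => 1 / (Z t - z))
      (continuous_const.div (hZc.sub continuous_const) hne).continuousOn
      (by rintro ⟨t, -, h⟩; exact one_div_ne_zero (hne t) h)
    exact ⟨l, continuousOn_univ.1 hl, fun t => hexp (Set.mem_univ t)⟩
  obtain ⟨y₀, hLc⟩ := hL.continuousOn
  -- The curve being simple, `L ∘ Z` can jump at one interior parameter at most.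
  obtain ⟨t₀, ht₀, hy₀⟩ : ∃ t₀ ∈ Set.Ioo 0 (2 * Real.pi),
      ∀ t ∈ Set.Ioo (0 : ℝ) (2 * Real.pi), t ≠ t₀ → Z t ≠ y₀ := by
    by_cases h : ∃ t ∈ Set.Ioo (0 : ℝ) (2 * Real.pi), Z t = y₀
    · obtain ⟨t₀, ht₀, rfl⟩ := h
      refine ⟨t₀, ht₀, fun t ht hne h => hne ?_⟩
      have hm := fun t : ℝ => openStrip_subset_closedStrip α (ofReal_mem_openStrip hα t)
      obtain ⟨k, hk⟩ := hZ.injective_mod_period t₀ (hm t₀) t (hm t) h.symm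
      have hk' : t = t₀ + 2 * Real.pi * k := by exact_mod_cast hk
      have h1 : (k : ℝ) < 1 := by
        by_contra! h1
        nlinarith [ht.2, ht₀.1]
      have h2 : (-1 : ℝ) < k := by
        by_contra! h2
        nlinarith [ht.1, ht₀.2]
      have hk0 : k = 0 := by
        have h1' : k < 1 := by exact_mod_cast h1
        have h2' : -1 < k := by exact_mod_cast h2
        omega
      simpa [hk0] using hk'
    · exact ⟨Real.pi, ⟨hpi, by linarith⟩, fun t ht _ h' => h ⟨t, ht, h'⟩⟩
  -- On each side of the jump, `L ∘ Z` and the continuous logarithm differ by a constant.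
  have hpiece : ∀ u v : ℝ, u < v → (∀ t ∈ Set.Ioo u v, Z t ≠ y₀) →
      IntervalIntegrable (fun t : ℝ => L (Z t)) MeasureTheory.volume u v := by
    intro u v huv hZy
    have hd : ContinuousOn (fun t : ℝ => (L (Z t) - l t) / (2 * Real.pi * I)) (Set.Ioo u v) := by
      refine ((hLc.comp hZc.continuousOn fun t ht => ⟨⟨t, rfl⟩, hZy t ht⟩).sub
        hl.continuousOn).div_const _
    have hint : ∀ t : ℝ, ∃ k : ℤ, L (Z t) = l t + (k : ℂ) * (2 * Real.pi * I) := fun t =>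
      exp_eq_exp_iff_exists_int.1 ((hL.exp_eq _ ⟨t, rfl⟩).trans (hlexp t).symm)
    choose k hk using hint
    have hkd : ∀ t : ℝ, (L (Z t) - l t) / (2 * Real.pi * I) = k t := by
      intro t
      rw [hk, add_sub_cancel_left, mul_div_cancel_right₀ _ two_pi_I_ne_zero]
    simp_rw [hkd] at hd
    have hkc : ContinuousOn k (Set.Ioo u v) :=
      Int.isClosedEmbedding_coe_real.isInducing.continuousOn_iff.2 (by
        have := continuous_re.comp_continuousOn hd
        simpa [Function.comp_def] using this)
    obtain ⟨m, hm⟩ : (Set.Ioo u v).Nonempty := Set.nonempty_Ioo.2 huv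
    refine IntervalIntegrable.congr_uIoo (f := fun t => l t + k m * (2 * Real.pi * I))
      ((hl.add continuous_const).intervalIntegrable _ _) ?_
    rw [Set.uIoo_of_lt huv]
    intro t ht
    dsimp only
    rw [hk t, isPreconnected_Ioo.constant hkc ht hm]
  refine (hpiece 0 t₀ ht₀.1 fun t ht => ?_).trans (hpiece t₀ _ ht₀.2 fun t ht => ?_)
  · exact hy₀ t ⟨ht.1, ht.2.trans ht₀.2⟩ ht.2.ne
  · exact hy₀ t ⟨ht₀.1.trans ht.1, ht.2⟩ ht.1.ne'

/-- The real parts of the complex potential and of its trapezoid rule are the single-layer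
potential and its own trapezoid rule, whatever the branch. -/
theorem re_complexSlpNative_sub (hZ : IsInvertibleOnStrip Z α) (hα : 0 < α) {z : ℂ}
    (hz : z ∉ curve Z) {σ : ℂ → ℝ} (hσ : DensityExtends Z α σ) {L : ℂ → ℂ}
    (hL : IsLogBranch (curve Z) z L) (N : ℕ) :
    (complexSlpNative Z σ L N - complexSlp Z σ L).re = slpNative Z σ N z - slp Z σ z := by
  have hre : ∀ t : ℝ, (complexSlpIntegrand Z σ L t).re = slpIntegrand Z σ z t := by
    intro t
    have hlog : (L (Z t)).re = Real.log (1 / ‖z - Z t‖) := by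
      rw [norm_sub_rev, ← Real.log_exp (L (Z t)).re, ← norm_exp, hL.exp_eq _ ⟨t, rfl⟩, norm_div,
        norm_one]
    have h1 : complexSlpIntegrand Z σ L t =
        ((1 / (2 * Real.pi) * σ (Z t) * ‖deriv Z t‖ : ℝ) : ℂ) * L (Z t) := by
      simp only [complexSlpIntegrand]
      push_cast
      ring
    rw [h1, re_ofReal_mul, hlog, slpIntegrand, fundSol]
    ring
  have hint : IntervalIntegrable (complexSlpIntegrand Z σ L) MeasureTheory.volume 0
      (2 * Real.pi) := by
    have hdc : Continuous fun t : ℝ => ‖deriv Z t‖ :=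
      ((hZ.differentiableOn.deriv (isOpen_openStrip α)).continuousOn.comp_continuous
        continuous_ofReal (ofReal_mem_openStrip hα)).norm
    have hσc : Continuous fun t : ℝ => (σ (Z t) : ℂ) := by
      obtain ⟨S, hS, -, hSσ⟩ := hσ
      have : Continuous fun t : ℝ => S (Z t) :=
        hS.continuousOn.comp_continuous (hZ.continuous_param hα)
          fun t => subset_closure ⟨t, ofReal_mem_openStrip hα t, rfl⟩
      simpa only [hSσ _ ⟨_, rfl⟩] using this
    have h := (hZ.intervalIntegrable_logBranch hα hz hL).continuousOn_mul
      (g := fun t : ℝ => 1 / (2 * Real.pi) * (σ (Z t) : ℂ) * (‖deriv Z t‖ : ℂ))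
      ((continuous_const.mul hσc).mul (continuous_ofReal.comp hdc)).continuousOn
    refine h.congr fun t _ => ?_
    simp only [complexSlpIntegrand]
    ring
  have hI : (complexSlp Z σ L).re = slp Z σ z := by
    have := reCLM.intervalIntegral_comp_comm hint
    simp only [reCLM_apply, hre] at this
    exact this.symm
  have hT : (complexSlpNative Z σ L N).re = slpNative Z σ N z := by
    simp only [complexSlpNative, slpNative, trapezoid, smul_re, re_sum, hre]
  rw [sub_re, hI, hT]

theorem slp_trapezoid_error (hZ : IsInvertibleOnStrip Z α) (hα : 0 < α) {σ : ℂ → ℝ}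
    (hσ : DensityExtends Z α σ) {s₀ : ℂ} (hs₀ : s₀ ∈ openStrip α) (h0 : s₀.im ≠ 0) :
    ∃ K : ℝ, ∀ N : ℕ, 1 ≤ N →
      |slpNative Z σ N (Z s₀) - slp Z σ (Z s₀)| ≤ K * Real.exp (-|s₀.im| * N) := by
  have ha := abs_pos.2 h0
  obtain ⟨β, hβ, hβα⟩ := exists_between (show |s₀.im| < α from hs₀)
  have hser : ExpSeries |s₀.im| fun t : ℝ => (slpIntegrand Z σ (Z s₀) t : ℂ) := by
    convert ((hZ.expSeries_log_norm_sub hα hs₀ h0).mul ha hβ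
      (hZ.expSeries_density hσ (ha.trans hβ) hβα)).const_mul (-1 / (2 * Real.pi)) using 2 with t
    rw [slpIntegrand, fundSol, one_div ‖_‖, Real.log_inv, norm_sub_rev]
    push_cast
    ring
  obtain ⟨K, hK⟩ := hser.trapezoid_error ha
  refine ⟨K, fun N hN => ?_⟩
  convert hK N hN using 1
  rw [← Real.norm_eq_abs, ← norm_real]
  congr 1
  simp only [slpNative, slp, trapezoid, intervalIntegral.integral_ofReal, real_smul,
    smul_eq_mul]
  push_cast
  rfl

end IsInvertibleOnStrip
end LaplaceSLP

theorem theoremt (Z : ℂ → ℂ) (σ : ℂ → ℝ) (α : ℝ) (hα : 0 < α)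
    (hZ : LaplaceSLP.IsInvertibleOnStrip Z α)
    (hσ : LaplaceSLP.DensityExtends Z α σ)
    (z : ℂ) (hz : z ∈ LaplaceSLP.annularNhd Z α \ LaplaceSLP.curve Z) :
    ∃ (C : ℝ) (N₀ : ℕ), ∀ s ∈ LaplaceSLP.openStrip α, Z s = z → ∀ N : ℕ, N₀ ≤ N →
      |LaplaceSLP.slpNative Z σ N z - LaplaceSLP.slp Z σ z| ≤ C * Real.exp (-|s.im| * N) ∧
      ∀ L : ℂ → ℂ, LaplaceSLP.IsLogBranch (LaplaceSLP.curve Z) z L →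
        |(LaplaceSLP.complexSlpNative Z σ L N - LaplaceSLP.complexSlp Z σ L).re| ≤
          C * Real.exp (-|s.im| * N) := by
  obtain ⟨⟨s₀, hs₀, rfl⟩, hcurve⟩ := hz
  have h0 : s₀.im ≠ 0 := fun h => hcurve ⟨s₀.re, by
    dsimp only
    congr 1
    exact Complex.ext rfl (by simp [h])⟩
  obtain ⟨K, hK⟩ := hZ.slp_trapezoid_error hα hσ hs₀ h0
  refine ⟨K, 1, fun s hs hsz N hN => ?_⟩
  have hsub := LaplaceSLP.openStrip_subset_closedStrip α
  -- All parameters of the target differ by multiples of `2π`, so they share the imaginary part.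
  obtain ⟨k, rfl⟩ := hZ.injective_mod_period s₀ (hsub hs₀) s (hsub hs) hsz.symm
  have him : (s₀ + 2 * Real.pi * k : ℂ).im = s₀.im := by simp [mul_assoc]
  rw [him]
  refine ⟨hK N hN, fun L hL => ?_⟩
  rw [hZ.re_complexSlpNative_sub hα hcurve hσ hL]
  exact hK N hN
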